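/- Let $\mathcal{Z}$ be a finite set, $\mathcal{H}_{\mathrm{all}}$ a set, $\ell:\mathcal{H}_{\mathrm{all}}\times\mathcal{Z}\to\mathbb{R}$ a function, and $\mathrm{DI}(\ell):=\sup_{h,z}\ell(h,z)-\inf_{h,z}\ell(h,z)\in[0,+\infty]$. Let $\mathcal{Z}^*:=\bigcup_{m\ge 0}\mathcal{Z}^m$ and let $\mathfrak{A}:\mathcal{Z}^*\to\mathcal{H}_{\mathrm{all}}$ be symmetric, i.e. $\mathfrak{A}(z_1,\dots,z_m)=\mathfrak{A}(z_{\sigma(1)},\dots,z_{\sigma(m)})$ for every $m$, every $z\in\mathcal{Z}^m$ and every permutation $\sigma$ of $\{1,\dots,m\}$. Let $Q$ be a probability distribution on $\mathcal{Z}$, let $n\ge 1$ be an integer, let $\mathbf{Z}=(Z_1,\dots,Z_n)\sim Q^n$, and for $h\in\mathcal{H}_{\mathrm{all}}$ and $\mathbf{z}\in\mathcal{Z}^n$ put $$\mathrm{GenGap}_{(\ell,Q,\mathbf{z})}(h):=\mathbb{E}_{Z\sim Q}\,\ell(h,Z)-\frac1n\sum_{i=1}^n\ell(h,z_i).$$ (1)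 For all $\delta_1,\delta_2,\delta_3>0$, with probability at least $1-(\delta_1+\delta_2+\delta_3)$, $$\mathrm{GenGap}_{(\ell,Q,\mathbf{Z})}(\mathfrak{A}(\mathbf{Z}))\le \mathrm{DI}(\ell)\sqrt{\frac{\left(|\mathcal{Z}|+\sqrt{\tfrac n2\ln\tfrac{2}{\delta_3}}\right)\left(3\ln n+\ln(2\pi)+\ln\tfrac1{\delta_2}\right)+\ln\tfrac1{\delta_1}}{2n}}.$$ (2) Suppose $\mathrm{DI}(\ell)>0$. For all $\delta,\varepsilon>0$, if $$n>\max\left\{24\,|\mathcal{Z}|\ln|\mathcal{Z}|\cdot\frac1{\varepsilon^2}\ln\frac{12}{\varepsilon^2},\ \omega(\delta,\varepsilon)\right\},\qquad \omega(\delta,\varepsilon):=\max\left\{\frac{324\ln\frac3\delta}{\varepsilon^4}\left(\ln\frac{9\sqrt{2\ln\frac3\delta}}{\varepsilon^2}\right)^2,\ \frac{3}{2\varepsilon^2}\ln\frac3\delta\right\},$$ then, with probability at least $1-\delta$, $$\mathrm{GenGap}_{(\ell,Q,\mathbf{Z})}(\mathfrak{A}(\mathbf{Z}))<\mathrm{DI}(\ell)\,\varepsilon.$$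 (In (1), if $\delta_1+\delta_2+\delta_3\ge 1$, and in (2), if $\delta\ge1$, the assertion is trivial, whatever value is given to the right-hand side or to $\omega$.) -/

import Mathlib

open MeasureTheory

noncomputable section

namespace GenGapFinite

variable {Z H T : Type*}

/-- The expected risk `E_{Z ∼ Q} ℓ(h, Z)` of a hypothesis `h`. -/
def risk [MeasurableSpace Z] (ℓ : H → Z → ℝ) (Q : Measure Z) (h : H) : ℝ :=
  ∫ z, ℓ h z ∂Q

/-- The empirical risk `(1/n) ∑ ℓ(h, z_i)` of a hypothesis `h` on a data sequence. -/
def empRisk {n : ℕ} (ℓ : H → Z → ℝ) (z : Fin n → Z) (h : H) : ℝ :=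
  (1 / (n : ℝ)) * ∑ i, ℓ h (z i)

/-- The generalization gap `Risk(h) - EmpRisk(h)`. -/
def genGap [MeasurableSpace Z] {n : ℕ} (ℓ : H → Z → ℝ) (Q : Measure Z) (z : Fin n → Z)
    (h : H) : ℝ :=
  risk ℓ Q h - empRisk ℓ z h

/-- The diameter of the image of the loss, `sup ℓ - inf ℓ`, which may be `+∞`. -/
def DI (ℓ : H → Z → ℝ) : EReal :=
  (⨆ (h : H) (z : Z), ((ℓ h z : ℝ) : EReal)) - (⨅ (h : H) (z : Z), ((ℓ h z : ℝ) : EReal))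

/-- A map on the set `Z*` of finite data sequences (lists) is symmetric if permuting the entries
of the sequence does not change its value. -/
def IsSymmetric (φ : List Z → T) : Prop :=
  ∀ (n : ℕ) (σ : Equiv.Perm (Fin n)) (z : Fin n → Z),
    φ (List.ofFn z) = φ (List.ofFn fun i => z (σ i))

/-- The threshold `ω(δ, ε)`, meant for `0 < δ ≤ 1` and `0 < ε`. -/
def omega (δ ε : ℝ) : ℝ :=
  max
    (324 * Real.log (3 / δ) / ε ^ 4
      * (Real.log (9 * Real.sqrt (2 * Real.log (3 / δ)) / ε ^ 2)) ^ 2)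
    (3 / (2 * ε ^ 2) * Real.log (3 / δ))

end GenGapFinite

end

/-!
A symmetric learner sees its sample only through the histogram of the sample, so on samples of
size `n` it returns at most `(n + 1) ^ |Z|` different hypotheses
(`GenGapFinite.card_image_ofFn_le`). A single hypothesis with losses in `[a, b]` has, by Hoeffding's
inequality, a generalization gap of at least `(b - a) s` with probability at most
`exp (-2 n s ^ 2)` (`GenGapFinite.measureReal_genGap_ge_le`). The union bound over the possible
outputs gives the tail estimate `(n + 1) ^ |Z| * exp (-2 n s ^ 2)` for the learner itself
(`GenGapFinite.measureReal_genGap_learner_ge_le`).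

Both claims follow from this estimate by comparing exponents: for the first,
`|Z| log (n + 1) ≤ |Z| (3 log n + log (2π))`, and the terms in `δ₂` and `δ₃` only enlarge the
right-hand side; for the second, `log (n + 1)` is bounded by its
tangent line at `2 |Z| / ε ^ 2`, which turns the lower bound on `n` into
`|Z| log (n + 1) + log (1 / δ) ≤ 2 n ε ^ 2`. This comparison needs `2 ≤ |Z|` and `ε ≤ 1`; the gap
vanishes when `|Z| = 1`, and it never exceeds `DI ℓ`, which settles `1 < ε`. An infinite `DI ℓ`
makes both claims trivial, and `DI ℓ = 0` makes the gap nonpositive.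
-/

open ProbabilityTheory

namespace GenGapFinite

variable {Z H T : Type*}

/-! ### Outputs of a symmetric map -/

/-- A symmetric map takes the same value on sequences of equal length with equal histograms. -/
lemma IsSymmetric.eq_of_card_fiber_eq [DecidableEq Z] {φ : List Z → T} (hφ : IsSymmetric φ) {n : ℕ}
    {x y : Fin n → Z}
    (h : ∀ c, Fintype.card {i // x i = c} = Fintype.card {i // y i = c}) :
    φ (List.ofFn x) = φ (List.ofFn y) := by
  have e : ∀ c, {i // x i = c} ≃ {i // y i = c} := fun c => Fintype.equivOfCardEq (h c)
  rw [hφ n (Equiv.ofFiberEquiv e) y]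
  congr 2
  funext i
  exact (Equiv.ofFiberEquiv_map e i).symm

lemma card_image_ofFn_le [Fintype Z] [DecidableEq T] {φ : List Z → T} (hφ : IsSymmetric φ) (n : ℕ) :
    (Finset.univ.image fun z : Fin n → Z => φ (List.ofFn z)).card
      ≤ (n + 1) ^ Fintype.card Z := by
  classical
  let hist : (Fin n → Z) → Z → Fin (n + 1) := fun z c =>
    ⟨Fintype.card {i // z i = c}, Nat.lt_succ_of_le <| by
      simpa using Fintype.card_subtype_le fun i => z i = c⟩
  -- `φ` on samples factors through the histogram, which takes at most `(n + 1) ^ |Z|` values.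
  have hfac : Function.FactorsThrough (fun z : Fin n → Z => φ (List.ofFn z)) hist :=
    fun x y hxy => hφ.eq_of_card_fiber_eq fun c => congrArg Fin.val (congrFun hxy c)
  have himg : (Finset.univ.image fun z : Fin n → Z => φ (List.ofFn z)) ⊆
      Finset.univ.image (Function.extend hist (fun z : Fin n → Z => φ (List.ofFn z))
        fun _ => φ []) := by
    intro t ht
    obtain ⟨z, -, rfl⟩ := Finset.mem_image.1 ht
    exact Finset.mem_image.2 ⟨hist z, Finset.mem_univ _, hfac.extend_apply _ _⟩
  calc _ ≤ _ := Finset.card_le_card himg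
    _ ≤ _ := Finset.card_image_le
    _ = _ := by simp

/-! ### Tail bounds for the generalization gap -/

lemma genGap_eq_inv_mul_sum [MeasurableSpace Z] {n : ℕ} (hn : 0 < n) (ℓ : H → Z → ℝ)
    (Q : Measure Z) (z : Fin n → Z) (h : H) :
    genGap ℓ Q z h = (1 / (n : ℝ)) * ∑ i, (risk ℓ Q h - ℓ h (z i)) := by
  have : (n : ℝ) ≠ 0 := by positivity
  simp only [genGap, empRisk, Finset.sum_sub_distrib, Finset.sum_const, Finset.card_univ,
    Fintype.card_fin, nsmul_eq_mul]
  field_simp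

lemma genGap_eq_zero_of_subsingleton [MeasurableSpace Z] [Subsingleton Z] (ℓ : H → Z → ℝ)
    (Q : Measure Z) [IsProbabilityMeasure Q] {n : ℕ} (hn : 0 < n) (z : Fin n → Z) (h : H) :
    genGap ℓ Q z h = 0 := by
  have hr (i : Fin n) : risk ℓ Q h = ℓ h (z i) := by
    have : ℓ h = fun _ => ℓ h (z i) := funext fun c => by rw [Subsingleton.elim c (z i)]
    rw [risk, this]
    simp
  rw [genGap_eq_inv_mul_sum hn]
  simp [← hr]

section Tail

variable [MeasurableSpace Z] [DiscreteMeasurableSpace Z] (Q : Measure Z)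
  [IsProbabilityMeasure Q]

lemma genGap_le [Fintype Z] {ℓ : H → Z → ℝ} {a b : ℝ} (hℓ : ∀ h z, ℓ h z ∈ Set.Icc a b) {n : ℕ}
    (hn : 0 < n) (z : Fin n → Z) (h : H) : genGap ℓ Q z h ≤ b - a := by
  have hrisk : risk ℓ Q h ≤ b := by
    have := integral_mono (μ := Q) (f := ℓ h) (g := fun _ => b) .of_finite .of_finite
      fun z => (hℓ h z).2
    simpa [risk] using this
  have hsum : ∑ i, (risk ℓ Q h - ℓ h (z i)) ≤ ∑ _i : Fin n, (b - a) :=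
    Finset.sum_le_sum fun i _ => sub_le_sub hrisk (hℓ h (z i)).1
  have hn' : (0 : ℝ) < n := by positivity
  rw [genGap_eq_inv_mul_sum hn, one_div, inv_mul_le_iff₀ hn']
  refine hsum.trans_eq ?_
  rw [Finset.sum_const, Finset.card_univ, Fintype.card_fin, nsmul_eq_mul]

/-- Hoeffding's inequality for a fixed hypothesis. -/
lemma measureReal_genGap_ge_le {ℓ : H → Z → ℝ} {a b : ℝ} (hab : a < b)
    (hℓ : ∀ h z, ℓ h z ∈ Set.Icc a b) {n : ℕ} (hn : 0 < n) (h : H) {s : ℝ} (hs : 0 ≤ s) :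
    (Measure.pi fun _ : Fin n => Q).real {z | (b - a) * s ≤ genGap ℓ Q z h}
      ≤ Real.exp (-2 * n * s ^ 2) := by
  have hn' : (0 : ℝ) < n := by positivity
  have hba : 0 < b - a := sub_pos.2 hab
  have hm : Measurable fun c : Z => risk ℓ Q h - ℓ h c := .of_discrete
  have hsubQ : HasSubgaussianMGF (fun c => risk ℓ Q h - ℓ h c) ((‖b - a‖₊ / 2) ^ 2) Q := by
    have := (hasSubgaussianMGF_of_mem_Icc (μ := Q) (X := ℓ h)
      (Measurable.of_discrete).aemeasurable (ae_of_all _ (hℓ h))).neg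
    refine this.congr (ae_of_all _ fun c => ?_)
    simp [risk]
  have hsub (i : Fin n) : HasSubgaussianMGF (fun z : Fin n → Z => risk ℓ Q h - ℓ h (z i))
      ((‖b - a‖₊ / 2) ^ 2) (Measure.pi fun _ : Fin n => Q) := by
    refine HasSubgaussianMGF.of_map (Y := fun z : Fin n → Z => z i)
      (X := fun c => risk ℓ Q h - ℓ h c) (measurable_pi_apply i).aemeasurable ?_
    rwa [(measurePreserving_eval (fun _ : Fin n => Q) i).map_eq]
  have hind : iIndepFun (fun (i : Fin n) (z : Fin n → Z) => risk ℓ Q h - ℓ h (z i))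
      (Measure.pi fun _ : Fin n => Q) :=
    iIndepFun_pi (X := fun _ c => risk ℓ Q h - ℓ h c) fun _ => hm.aemeasurable
  have key := HasSubgaussianMGF.measure_sum_ge_le_of_iIndepFun hind (s := Finset.univ)
    (fun i _ => hsub i) (ε := n * ((b - a) * s)) (by positivity)
  have hset : {z : Fin n → Z | (b - a) * s ≤ genGap ℓ Q z h} =
      {z | n * ((b - a) * s) ≤ ∑ i, (risk ℓ Q h - ℓ h (z i))} := by
    ext z
    rw [Set.mem_ofPred_eq, Set.mem_ofPred_eq, genGap_eq_inv_mul_sum hn, one_div,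
      le_inv_mul_iff₀ hn']
  rw [hset]
  refine key.trans_eq (congrArg Real.exp ?_)
  have hnorm : |b - a| = b - a := abs_of_pos hba
  simp only [Finset.sum_const, Finset.card_univ, Fintype.card_fin, nsmul_eq_mul]
  push_cast
  rw [Real.norm_eq_abs, hnorm]
  field_simp

lemma measureReal_genGap_learner_ge_le [Fintype Z] {ℓ : H → Z → ℝ} {a b : ℝ} (hab : a < b)
    (hℓ : ∀ h z, ℓ h z ∈ Set.Icc a b) {A : List Z → H} (hA : IsSymmetric A) {n : ℕ} (hn : 0 < n)
    {s : ℝ} (hs : 0 ≤ s) :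
    (Measure.pi fun _ : Fin n => Q).real {z | (b - a) * s ≤ genGap ℓ Q z (A (List.ofFn z))}
      ≤ ((n : ℝ) + 1) ^ Fintype.card Z * Real.exp (-2 * n * s ^ 2) := by
  classical
  set S : Finset H := Finset.univ.image fun z : Fin n → Z => A (List.ofFn z)
  calc _ ≤ (Measure.pi fun _ : Fin n => Q).real
        (⋃ h ∈ S, {z | (b - a) * s ≤ genGap ℓ Q z h}) :=
        measureReal_mono (fun z hz => Set.mem_iUnion₂.2
          ⟨_, Finset.mem_image_of_mem _ (Finset.mem_univ z), hz⟩) (measure_ne_top _ _)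
    _ ≤ ∑ h ∈ S, (Measure.pi fun _ : Fin n => Q).real {z | (b - a) * s ≤ genGap ℓ Q z h} :=
        measureReal_biUnion_finset_le _ _
    _ ≤ ∑ _h ∈ S, Real.exp (-2 * n * s ^ 2) :=
        Finset.sum_le_sum fun h _ => measureReal_genGap_ge_le Q hab hℓ hn h hs
    _ = S.card * Real.exp (-2 * n * s ^ 2) := by simp
    _ ≤ _ := by
        gcongr
        exact_mod_cast card_image_ofFn_le hA n

/-- The tail bound for the learner in the form of a confidence level. -/
lemma measureReal_genGap_learner_ge_le_of_log_le [Fintype Z] {ℓ : H → Z → ℝ} {a b : ℝ} (hab : a < b)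
    (hℓ : ∀ h z, ℓ h z ∈ Set.Icc a b) {A : List Z → H} (hA : IsSymmetric A) {n : ℕ} (hn : 0 < n)
    {s δ : ℝ} (hs : 0 ≤ s) (hδ : 0 < δ)
    (hlog : Fintype.card Z * Real.log (n + 1) + Real.log (1 / δ) ≤ 2 * n * s ^ 2) :
    (Measure.pi fun _ : Fin n => Q).real {z | (b - a) * s ≤ genGap ℓ Q z (A (List.ofFn z))}
      ≤ δ := by
  refine (measureReal_genGap_learner_ge_le Q hab hℓ hA hn hs).trans ?_
  have hn1 : (0 : ℝ) < n + 1 := by positivity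
  rw [one_div, Real.log_inv] at hlog
  rw [← Real.rpow_natCast, Real.rpow_def_of_pos hn1, ← Real.exp_add,
    ← Real.le_log_iff_exp_le hδ]
  linarith

end Tail

lemma one_sub_le_measureReal {Ω : Type*} [MeasurableSpace Ω] (μ : Measure Ω)
    [IsProbabilityMeasure μ] {s t : Set Ω} (hst : sᶜ ⊆ t) {p : ℝ} (ht : μ.real t ≤ p) :
    1 - p ≤ μ.real s := by
  have h1 : μ.real (s ∪ sᶜ) ≤ μ.real s + μ.real sᶜ := measureReal_union_le _ _
  have h2 : μ.real sᶜ ≤ μ.real t := measureReal_mono hst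
  simp only [Set.union_compl_self, probReal_univ] at h1
  linarith

/-! ### The diameter of the loss -/

lemma DI_eq_top_or_exists_Icc [Nonempty H] [Nonempty Z] (ℓ : H → Z → ℝ) :
    DI ℓ = ⊤ ∨ ∃ a b : ℝ, (∀ h z, ℓ h z ∈ Set.Icc a b) ∧ DI ℓ = ((b - a : ℝ) : EReal) := by
  obtain ⟨h₀⟩ := ‹Nonempty H›
  obtain ⟨z₀⟩ := ‹Nonempty Z›
  have hle (h : H) (z : Z) : ((ℓ h z : ℝ) : EReal) ≤ ⨆ (h : H) (z : Z), ((ℓ h z : ℝ) : EReal) :=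
    le_iSup₂ (f := fun h z => ((ℓ h z : ℝ) : EReal)) h z
  have hge (h : H) (z : Z) : ⨅ (h : H) (z : Z), ((ℓ h z : ℝ) : EReal) ≤ ((ℓ h z : ℝ) : EReal) :=
    iInf₂_le (f := fun h z => ((ℓ h z : ℝ) : EReal)) h z
  unfold DI
  generalize (⨆ (h : H) (z : Z), ((ℓ h z : ℝ) : EReal)) = u at hle
  generalize (⨅ (h : H) (z : Z), ((ℓ h z : ℝ) : EReal)) = v at hge
  have hu : u ≠ ⊥ := ((EReal.bot_lt_coe _).trans_le (hle h₀ z₀)).ne'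
  have hv : v ≠ ⊤ := ((hge h₀ z₀).trans_lt (EReal.coe_lt_top _)).ne
  by_cases hu' : u = ⊤
  · exact .inl (by rw [hu', EReal.top_sub hv])
  by_cases hv' : v = ⊥
  · exact .inl (by rw [hv', EReal.sub_bot hu])
  lift u to ℝ using ⟨hu', hu⟩
  lift v to ℝ using ⟨hv, hv'⟩
  exact .inr ⟨v, u, fun h z =>
    ⟨EReal.coe_le_coe_iff.1 (hge h z), EReal.coe_le_coe_iff.1 (hle h z)⟩, (EReal.coe_sub _ _).symm⟩

/-! ### Comparison of exponents -/

/-- In the first claim, `q` is the square root containing `δ₃` and `L` is `log (1 / δ₂)`. -/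
lemma mul_log_succ_le {n : ℕ} (hn : 0 < n) {k q L : ℝ} (hk : 0 ≤ k) (hq : 0 ≤ q) (hL : 0 ≤ L) :
    k * Real.log (n + 1) ≤ (k + q) * (3 * Real.log n + Real.log (2 * Real.pi) + L) := by
  have hn1 : (1 : ℝ) ≤ n := by exact_mod_cast hn
  have hlog : 0 ≤ Real.log n := Real.log_nonneg hn1
  have hle : Real.log (n + 1) ≤ Real.log n + Real.log (2 * Real.pi) := by
    rw [← Real.log_mul (by positivity) (by positivity)]
    apply Real.log_le_log (by positivity)
    nlinarith [Real.pi_gt_three]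
  have h0 : 0 ≤ Real.log (n + 1) := Real.log_nonneg (by linarith)
  apply mul_le_mul <;> linarith

/-- Here `k` is the cardinality of the data space and `n` the sample size. The assumption `2 ≤ k` is
needed because `h1` is void at `k = 1`. -/
lemma mul_log_succ_add_log_le {k ε δ n : ℝ} (hk : 2 ≤ k) (hε : 0 < ε) (hε1 : ε ≤ 1) (hδ : 0 < δ)
    (hn : 1 ≤ n) (h1 : 24 * k * Real.log k * (1 / ε ^ 2) * Real.log (12 / ε ^ 2) ≤ n)
    (h2 : 3 / (2 * ε ^ 2) * Real.log (3 / δ) ≤ n) :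
    k * Real.log (n + 1) + Real.log (1 / δ) ≤ 2 * n * ε ^ 2 := by
  have hk0 : 0 < k := by linarith
  have hε2 : 0 < ε ^ 2 := by positivity
  have hε2' : ε ^ 2 ≤ 1 := pow_le_one₀ hε.le hε1
  set l := Real.log k with hl
  set L := Real.log (12 / ε ^ 2) with hL
  have hl2 : 1 / 2 ≤ l := by
    have := Real.log_le_log (by norm_num) hk
    linarith [Real.log_two_gt_d9]
  have hL2 : 1 ≤ L := by
    rw [hL, Real.le_log_iff_exp_le (by positivity), le_div_iff₀ hε2]
    nlinarith [Real.exp_one_lt_d9, Real.exp_pos 1]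
  -- The tangent line of `log` at `2 k / ε ^ 2`.
  have htan : Real.log (n + 1) ≤ (n + 1) * ε ^ 2 / (2 * k) + (l + L) := by
    have hx : 0 < (n + 1) * ε ^ 2 / (2 * k) := by positivity
    have hc : Real.log (2 * k / ε ^ 2) ≤ l + L := by
      rw [hl, hL, ← Real.log_mul (by positivity) (by positivity)]
      apply Real.log_le_log (by positivity)
      rw [mul_div_assoc', mul_comm 2 k]
      gcongr
      norm_num
    have hsplit : n + 1 = (n + 1) * ε ^ 2 / (2 * k) * (2 * k / ε ^ 2) := by field_simp
    have hlog : Real.log (n + 1) =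
        Real.log ((n + 1) * ε ^ 2 / (2 * k)) + Real.log (2 * k / ε ^ 2) := by
      rw [← Real.log_mul hx.ne' (by positivity), ← hsplit]
    have := Real.log_le_sub_one_of_pos hx
    linarith
  have hmul : k * Real.log (n + 1) ≤ (n + 1) * ε ^ 2 / 2 + k * (l + L) := by
    calc _ ≤ k * ((n + 1) * ε ^ 2 / (2 * k) + (l + L)) := by gcongr
      _ = _ := by field_simp
  have h1' : 24 * k * (l * L) ≤ n * ε ^ 2 := by
    calc _ = (24 * k * l * (1 / ε ^ 2) * L) * ε ^ 2 := by field_simp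
      _ ≤ _ := by gcongr
  have hlL : l + L ≤ 3 * (l * L) := by nlinarith
  have h3 : k * (l + L) ≤ k * (3 * (l * L)) := by gcongr
  have h2' : 3 / 2 * Real.log (3 / δ) ≤ n * ε ^ 2 := by
    calc _ = (3 / (2 * ε ^ 2) * Real.log (3 / δ)) * ε ^ 2 := by field_simp
      _ ≤ _ := by gcongr
  have hδ3 : Real.log (1 / δ) ≤ Real.log (3 / δ) := by gcongr; norm_num
  have hnε : ε ^ 2 ≤ n * ε ^ 2 := by nlinarith
  have hnε0 : 0 < n * ε ^ 2 := by positivity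
  nlinarith

end GenGapFinite

/-! ### Generalization bounds for symmetric learners -/

open GenGapFinite in
theorem mainTheorem6 {Z H : Type*} [Fintype Z] [MeasurableSpace Z] [DiscreteMeasurableSpace Z]
    (ℓ : H → Z → ℝ) (A : List Z → H) (hA : GenGapFinite.IsSymmetric A)
    (Q : Measure Z) [IsProbabilityMeasure Q] (n : ℕ) (hn : 0 < n) :
    (∀ δ₁ δ₂ δ₃ : ℝ, 0 < δ₁ → 0 < δ₂ → 0 < δ₃ →
      1 - (δ₁ + δ₂ + δ₃) ≤
        (Measure.pi fun _ : Fin n => Q).real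
          {z | ((GenGapFinite.genGap ℓ Q z (A (List.ofFn z)) : ℝ) : EReal) ≤
            GenGapFinite.DI ℓ *
              ((Real.sqrt
                ((((Fintype.card Z : ℝ) + Real.sqrt ((n : ℝ) / 2 * Real.log (2 / δ₃)))
                    * (3 * Real.log n + Real.log (2 * Real.pi) + Real.log (1 / δ₂))
                  + Real.log (1 / δ₁)) / (2 * (n : ℝ))) : ℝ) : EReal)}) ∧
    (0 < GenGapFinite.DI ℓ → ∀ δ ε : ℝ, 0 < δ → 0 < ε →
      max (24 * (Fintype.card Z : ℝ) * Real.log (Fintype.card Z) * (1 / ε ^ 2)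
            * Real.log (12 / ε ^ 2))
          (GenGapFinite.omega δ ε) < (n : ℝ) →
      1 - δ ≤
        (Measure.pi fun _ : Fin n => Q).real
          {z | ((GenGapFinite.genGap ℓ Q z (A (List.ofFn z)) : ℝ) : EReal) <
            GenGapFinite.DI ℓ * (ε : EReal)}) := by
  have : Nonempty H := ⟨A []⟩
  have : Nonempty Z := nonempty_of_isProbabilityMeasure Q
  have hn0 : (0 : ℝ) < n := by exact_mod_cast hn
  have hn1 : (1 : ℝ) ≤ n := by exact_mod_cast hn
  have hk1 : (1 : ℝ) ≤ Fintype.card Z := by exact_mod_cast Fintype.card_pos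
  constructor
  · intro δ₁ δ₂ δ₃ h₁ h₂ h₃
    -- Below, `δ₁` and `δ₂` are smaller than `1`, so that their logarithms have the right sign.
    rcases le_or_gt 1 (δ₁ + δ₂ + δ₃) with hδ | hδ
    · exact (sub_nonpos.2 hδ).trans measureReal_nonneg
    have hL₁ : 0 ≤ Real.log (1 / δ₁) := Real.log_nonneg (by rw [le_div_iff₀ h₁]; linarith)
    have hL₂ : 0 ≤ Real.log (1 / δ₂) := Real.log_nonneg (by rw [le_div_iff₀ h₂]; linarith)
    have hexp := mul_log_succ_le hn (k := Fintype.card Z) (by positivity)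
      (Real.sqrt_nonneg ((n : ℝ) / 2 * Real.log (2 / δ₃))) hL₂
    have hpos : 0 < (Fintype.card Z : ℝ) * Real.log (n + 1) :=
      mul_pos (by linarith) (Real.log_pos (by linarith))
    set X : ℝ := ((Fintype.card Z : ℝ) + Real.sqrt ((n : ℝ) / 2 * Real.log (2 / δ₃)))
      * (3 * Real.log n + Real.log (2 * Real.pi) + Real.log (1 / δ₂)) + Real.log (1 / δ₁)
    have hX0 : 0 < X := by linarith
    have hs : 0 < Real.sqrt (X / (2 * (n : ℝ))) := Real.sqrt_pos.2 (by positivity)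
    have hs2 : 2 * (n : ℝ) * Real.sqrt (X / (2 * (n : ℝ))) ^ 2 = X := by
      rw [Real.sq_sqrt (by positivity)]
      field_simp
    set s : ℝ := Real.sqrt (X / (2 * (n : ℝ)))
    rcases DI_eq_top_or_exists_Icc ℓ with htop | ⟨a, b, hℓ, hDI⟩
    · simp only [htop, EReal.top_mul_coe_of_pos hs, le_top, Set.ofPred_true, probReal_univ]
      linarith
    simp only [hDI, ← EReal.coe_mul, EReal.coe_le_coe_iff]
    have hab : a ≤ b :=
      (hℓ (A []) (Classical.arbitrary Z)).1.trans (hℓ (A []) (Classical.arbitrary Z)).2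
    -- The Hoeffding bound at level `(b - a) s` says nothing when `b = a`.
    rcases hab.eq_or_lt with rfl | hab
    · have hgap (z : Fin n → Z) : genGap ℓ Q z (A (List.ofFn z)) ≤ (a - a) * s := by
        simpa using genGap_le Q hℓ hn z (A (List.ofFn z))
      simp only [hgap, Set.ofPred_true, probReal_univ]
      linarith
    refine one_sub_le_measureReal _ (t := {z | (b - a) * s ≤ genGap ℓ Q z (A (List.ofFn z))})
      (fun z hz => by
        simp only [Set.mem_compl_iff, Set.mem_ofPred_eq, not_le] at hz ⊢
        exact hz.le) ?_
    have := measureReal_genGap_learner_ge_le_of_log_le Q hab hℓ hA hn hs.le h₁ (by linarith)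
    linarith
  · intro hDI0 δ ε hδ hε hmax
    have hω := (le_max_right _ _).trans_lt hmax
    have hn₁ := (le_max_left _ _).trans_lt hmax
    have hn₂ : 3 / (2 * ε ^ 2) * Real.log (3 / δ) < n := (le_max_right _ _).trans_lt hω
    rcases DI_eq_top_or_exists_Icc ℓ with htop | ⟨a, b, hℓ, hDI⟩
    · simp only [htop, EReal.top_mul_coe_of_pos hε, EReal.coe_lt_top, Set.ofPred_true,
        probReal_univ]
      linarith
    rw [hDI, EReal.coe_pos] at hDI0
    simp only [hDI, ← EReal.coe_mul, EReal.coe_lt_coe_iff]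
    refine one_sub_le_measureReal _ (t := {z | (b - a) * ε ≤ genGap ℓ Q z (A (List.ofFn z))})
      (fun z hz => by
        simpa only [Set.mem_compl_iff, Set.mem_ofPred_eq, not_lt] using hz) ?_
    rcases lt_or_ge 1 ε with hε1 | hε1
    · have hgap (z : Fin n → Z) : ¬ (b - a) * ε ≤ genGap ℓ Q z (A (List.ofFn z)) := by
        have := genGap_le Q hℓ hn z (A (List.ofFn z))
        nlinarith
      simpa only [hgap, Set.ofPred_false, measureReal_empty] using hδ.le
    rcases subsingleton_or_nontrivial Z with hZ | hZ
    · have hgap (z : Fin n → Z) : ¬ (b - a) * ε ≤ genGap ℓ Q z (A (List.ofFn z)) := by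
        rw [genGap_eq_zero_of_subsingleton ℓ Q hn, not_le]
        positivity
      simpa only [hgap, Set.ofPred_false, measureReal_empty] using hδ.le
    have hk2 : (2 : ℝ) ≤ Fintype.card Z := by exact_mod_cast Fintype.one_lt_card (α := Z)
    exact measureReal_genGap_learner_ge_le_of_log_le Q (sub_pos.1 hDI0) hℓ hA hn hε.le hδ
      (mul_log_succ_add_log_le hk2 hε hε1 hδ hn1 hn₁.le hn₂.le)
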